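/- **Proposition.** Consider a continuous-time Markov decision process with finite state space $\mathcal S$ ($S=|\mathcal S|$), finite action space $\mathcal A$ ($A=|\mathcal A|$), horizon $[0,H]$ with $0<H<\infty$, initial state $x_0$, reward rates $r(x,a)\in[0,1]$, exponential holding times with rates $\lambda(x,a)$, and transition probabilities $p(\cdot\mid x,a)$, where $\lambda(x,a)\in[\lambda_{\min},\lambda_{\max}]$ for all $(x,a)$ with constants $\lambda_{\min},\lambda_{\max}\in(0,\infty)$. An arbitrary learning algorithm interacts with the process for $K\ge 2$ episodes: each episode starts in $x_0$, and throughout episode $k$ the algorithm executes a deterministic Markov policy $\pi_k$ that it computes from the data of episodes $1,\dots,k-1$. Let $x_m^k$, $a_m^k$, $\tau_m^k$ be the $m$-th state, action and holding time in episode $k$, with jump times $t_m^k=\sum_{i=0}^{m-1}\tau_i^k$ and $a_m^k=\pi_k\big(x_m^k,(H-t_m^k)^+\big)$. Thus, conditionally on all earlier episodes and on the current episode up to the choice of $a_m^k$, the probability that $\tau_m^k\le t$ and $x_{m+1}^k=y$ is $\big(1-e^{-\lambda(x_m^k,a_m^k)t}\big)\,p(y\mid x_m^k,a_m^k)$, for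 all $t\ge0$ and $y\in\mathcal S$. Let $$T^k(x,a)=\sum_{l=1}^{k-1}\sum_{n=0}^\infty \min\{\tau_n^l,\,H-t_n^l\}\cdot 1_{\{(x_n^l,a_n^l)=(x,a)\}}\cdot 1_{\{t_n^l\le H\}}$$ be the time spent at the state--action pair $(x,a)$ up to the end of episode $k-1$ (holding times being truncated at the horizon $H$), and let $L(\delta)=4\ln(2SAK/\delta)$. Then, for every $\delta\in(0,1)$, $$\mathbb E\left[\sum_{k=1}^K\sum_{m=0}^\infty\frac{(H-t_m^k)^+}{\sqrt{\max\{T^k(x_m^k,a_m^k),\,L(\delta)/\lambda_{\max}\}}}\right]\le \sqrt{2\lambda_{\max}}\cdot 3\left(H+\frac1{\lambda_{\min}}\right)\sqrt{SAK}\cdot\frac{(\lambda_{\max}H+1)\ln K}{\ln(\ln K+1)} .$$ -/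

import Mathlib

open MeasureTheory ProbabilityTheory

noncomputable section

namespace EpisodicCTMDP

/-- A finite-horizon continuous-time Markov decision process `(𝒮, 𝒜, r, λ, p, H, x₀)`:
in state `x` under action `a` the process stays for an exponential time of rate `rate x a`, earning
reward at rate `reward x a`, and then jumps to `y` with probability `trans x a y`. -/
structure CTMDP (S A : Type*) [Fintype S] where
  reward : S → A → ℝ
  rate : S → A → ℝ
  trans : S → A → S → ℝ
  horizon : ℝ
  init : S
  trans_nonneg : ∀ x a y, 0 ≤ trans x a y
  trans_sum : ∀ x a, ∑ y, trans x a y = 1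
  horizon_pos : 0 < horizon

/-- The standing assumption: holding-time rates lie in `[lmin, lmax]` with
`lmin, lmax ∈ (0, ∞)`, and reward rates lie in `[0, 1]`. -/
structure CTMDP.IsBounded {S A : Type*} [Fintype S] (M : CTMDP S A) (lmin lmax : ℝ) : Prop where
  lmin_pos : 0 < lmin
  lmax_pos : 0 < lmax
  le_rate : ∀ x a, lmin ≤ M.rate x a
  rate_le : ∀ x a, M.rate x a ≤ lmax
  reward_nonneg : ∀ x a, 0 ≤ M.reward x a
  reward_le_one : ∀ x a, M.reward x a ≤ 1

/-- The trajectory of one episode: the states `x_n`, actions `a_n` and (untruncated) holding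
times `τ_n`, `n = 0, 1, 2, …`. -/
structure Episode (S A : Type*) where
  state : ℕ → S
  action : ℕ → A
  hold : ℕ → ℝ

namespace Episode

variable {S A : Type*} (e : Episode S A)

/-- The `n`-th jump time `t_n = ∑_{i < n} τ_i`, with `t_0 = 0`. -/
def jumpTime (n : ℕ) : ℝ := ∑ i ∈ Finset.range n, e.hold i

open scoped Classical in
/-- The time spent at the pair `(x, a)` in one episode within the horizon `[0, H]`. The holding
time that starts at `t_n ≤ H` is counted up to time `H` only, i.e. as `min τ_n (H - t_n)`. -/
def timeSpent (H : ℝ) (x : S) (a : A) : ℝ :=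
  ∑' n : ℕ, if (e.state n = x ∧ e.action n = a) ∧ e.jumpTime n ≤ H
    then min (e.hold n) (H - e.jumpTime n) else 0

end Episode

/-- The accumulated time `T^k(x, a)` spent at `(x, a)` before episode `k`
(episodes are numbered `0, 1, 2, …`). -/
def accTime {S A : Type*} (H : ℝ) (E : ℕ → Episode S A) (k : ℕ) (x : S) (a : A) : ℝ :=
  ∑ l ∈ Finset.range k, (E l).timeSpent H x a

/-- A learning algorithm computes, from the data of the `k` past episodes, the deterministic Markov
policy (a function of the state and the remaining time) that it executes throughout the next
episode. -/
abbrev LearningAlgorithm (S A : Type*) : Type _ :=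
  (k : ℕ) → (Fin k → Episode S A) → S → ℝ → A

/-- The information available at the `m`-th decision of episode `k`, just after the action is
chosen: all data of the episodes before `k`, and `x_0, a_0, τ_0, …, τ_{m-1}, x_m, a_m` in
episode `k`. -/
@[reducible] def history {Ω S A : Type*} [mS : MeasurableSpace S] [mA : MeasurableSpace A]
    (E : ℕ → Ω → Episode S A) (k m : ℕ) : MeasurableSpace Ω :=
  (⨆ l : ℕ, ⨆ _ : l < k, ⨆ n : ℕ,
    mS.comap (fun ω => (E l ω).state n) ⊔ mA.comap (fun ω => (E l ω).action n) ⊔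
      (borel ℝ).comap (fun ω => (E l ω).hold n)) ⊔
  (⨆ n : ℕ, ⨆ _ : n ≤ m,
    mS.comap (fun ω => (E k ω).state n) ⊔ mA.comap (fun ω => (E k ω).action n)) ⊔
  (⨆ n : ℕ, ⨆ _ : n < m, (borel ℝ).comap (fun ω => (E k ω).hold n))

/-- `E 0, …, E (K - 1)` are the trajectories of `K` episodes of interaction of the learning
algorithm `algo` with the model `M`, on the probability space `(Ω, P)`. -/
structure IsRun {Ω S A : Type*} [MeasurableSpace Ω] [Fintype S] [MeasurableSpace S]
    [MeasurableSpace A] (P : Measure Ω) (M : CTMDP S A) (algo : LearningAlgorithm S A) (K : ℕ)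
    (E : ℕ → Ω → Episode S A) : Prop where
  measurable_state : ∀ k < K, ∀ n, Measurable fun ω => (E k ω).state n
  measurable_action : ∀ k < K, ∀ n, Measurable fun ω => (E k ω).action n
  measurable_hold : ∀ k < K, ∀ n, Measurable fun ω => (E k ω).hold n
  /-- Every episode starts in the initial state. -/
  state_zero : ∀ k < K, ∀ ω, (E k ω).state 0 = M.init
  /-- `a_n^k = π_k (x_n^k, (H - t_n^k)⁺)`, where `π_k` is computed from the past episodes. -/
  action_eq : ∀ k < K, ∀ n ω, (E k ω).action n =
    algo k (fun l => E l ω) ((E k ω).state n) (max (M.horizon - (E k ω).jumpTime n) 0)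
  /-- Given the history, the holding time is at most `t` and the next state is `y` with
  probability `(1 - exp (-λ(x, a) t)) p(y | x, a)`, where `(x, a)` is the current pair. -/
  step_law : ∀ k < K, ∀ n, ∀ t : ℝ, 0 ≤ t → ∀ y : S,
    P[Set.indicator {ω | (E k ω).hold n ≤ t ∧ (E k ω).state (n + 1) = y} (fun _ => (1 : ℝ)) |
        history E k n]
      =ᵐ[P] fun ω =>
        (1 - Real.exp (-(M.rate ((E k ω).state n) ((E k ω).action n) * t))) *
          M.trans ((E k ω).state n) ((E k ω).action n) y

/-- `L(δ) = 4 ln (2 S A K / δ)`. -/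
def logTerm (S A : Type*) [Fintype S] [Fintype A] (K : ℕ) (δ : ℝ) : ℝ :=
  4 * Real.log (2 * Fintype.card S * Fintype.card A * K / δ)

end EpisodicCTMDP

end

/-! Write `W` for the remaining time `(H - t_m)⁺` and `τ` for the `m`-th holding time. `W` and the
weight `1/√(max T c)` are both known when the action is chosen, and given that history `τ` has tail
at least `exp (-lmax t)`. A variable with this tail satisfies `E[min τ w] ≥ (1 - exp (-lmax w)) /
lmax ≥ w / (1 + lmax w)`. So, in expectation, `W` may be replaced by the truncated holding time `min
τ W` at the cost of a factor `1 + lmax H` (`lintegral_ofReal_mul_le_of_exp_le_condExp`).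

The rest is pathwise (`sum_tsum_sojourn_le`). Grouped by state-action pair, the truncated holding
times add up to the increments of `T^k(x, a)`. Each pair then contributes a sum `∑ D_k / √(max T_k
c)`, which telescopes to a multiple of `√T_K`. Cauchy-Schwarz over the pairs, with total time at
most `K H`, gives order `√(SAKH)`. The logarithmic factor of the statement is at least 1, so it is
pure slack. -/

namespace EpisodicCTMDP

/-! ### Truncated holding times within one episode. -/

namespace Episode

variable {S A : Type*} (e : Episode S A)

/-- The `n`-th holding time, truncated at the horizon. -/
noncomputable def sojourn (H : ℝ) (n : ℕ) : ℝ := min (e.hold n) (max (H - e.jumpTime n) 0)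

variable {e} {H : ℝ}

theorem sojourn_nonneg (he : ∀ n, 0 ≤ e.hold n) (n : ℕ) : 0 ≤ e.sojourn H n :=
  le_min (he n) (le_max_right _ _)

/-- The truncated clock follows the true one until the horizon and then stops. -/
theorem sum_range_sojourn (he : ∀ n, 0 ≤ e.hold n) (hH : 0 ≤ H) (N : ℕ) :
    ∑ n ∈ Finset.range N, e.sojourn H n = min (e.jumpTime N) H := by
  induction N with
  | zero => simp [jumpTime, hH]
  | succ N ih =>
    have h := he N
    have hj : e.jumpTime (N + 1) = e.jumpTime N + e.hold N := Finset.sum_range_succ _ _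
    rw [Finset.sum_range_succ, ih, hj, sojourn]
    grind

theorem summable_sojourn (he : ∀ n, 0 ≤ e.hold n) (hH : 0 ≤ H) : Summable (e.sojourn H) :=
  summable_of_sum_range_le (sojourn_nonneg he) fun N =>
    (sum_range_sojourn he hH N).trans_le (min_le_right _ _)

theorem tsum_sojourn_le (he : ∀ n, 0 ≤ e.hold n) (hH : 0 ≤ H) : ∑' n, e.sojourn H n ≤ H :=
  Real.tsum_le_of_sum_range_le (sojourn_nonneg he) fun N =>
    (sum_range_sojourn he hH N).trans_le (min_le_right _ _)

open scoped Classical in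
-- Past the horizon the truncated holding time is already 0, so the condition `t_n ≤ H` can be
-- dropped.
theorem timeSpent_eq_tsum_sojourn (he : ∀ n, 0 ≤ e.hold n) (x : S) (a : A) :
    e.timeSpent H x a = ∑' n, if e.state n = x ∧ e.action n = a then e.sojourn H n else 0 := by
  unfold timeSpent sojourn
  refine tsum_congr fun n => ?_
  have h := he n
  grind

open scoped Classical in
theorem ofReal_timeSpent (he : ∀ n, 0 ≤ e.hold n) (hH : 0 ≤ H) (x : S) (a : A) :
    ENNReal.ofReal (e.timeSpent H x a) =
      ∑' n, if e.state n = x ∧ e.action n = a then ENNReal.ofReal (e.sojourn H n) else 0 := by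
  have h0 := sojourn_nonneg (H := H) he
  rw [timeSpent_eq_tsum_sojourn he, ENNReal.ofReal_tsum_of_nonneg]
  · exact tsum_congr fun n => by split_ifs <;> simp
  · intro n; split_ifs
    exacts [h0 n, le_rfl]
  · refine (summable_sojourn he hH).of_nonneg_of_le (fun n => ?_) fun n => ?_ <;> split_ifs
    exacts [h0 n, le_rfl, le_rfl, h0 n]

theorem timeSpent_nonneg (he : ∀ n, 0 ≤ e.hold n) (x : S) (a : A) : 0 ≤ e.timeSpent H x a := by
  classical
  rw [timeSpent_eq_tsum_sojourn he]
  refine tsum_nonneg fun n => ?_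
  split_ifs
  exacts [sojourn_nonneg he n, le_rfl]

/-- Summing a function of the state-action pair along an episode, weighted by the time spent. -/
theorem tsum_sojourn_mul [Fintype S] [Fintype A] (he : ∀ n, 0 ≤ e.hold n) (hH : 0 ≤ H)
    (F : S → A → ENNReal) :
    ∑' n, ENNReal.ofReal (e.sojourn H n) * F (e.state n) (e.action n) =
      ∑ x, ∑ a, ENNReal.ofReal (e.timeSpent H x a) * F x a := by
  classical
  simp_rw [ofReal_timeSpent he hH, ← ENNReal.tsum_mul_right]
  simp_rw [← Summable.tsum_finsetSum fun _ _ => ENNReal.summable]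
  refine tsum_congr fun n => ?_
  rw [Finset.sum_eq_single (e.state n), Finset.sum_eq_single (e.action n)]
  · simp
  · intro a _ h; rw [if_neg (by tauto), zero_mul]
  · simp
  · intro x _ h
    exact Finset.sum_eq_zero fun a _ => by rw [if_neg (by tauto), zero_mul]
  · simp

theorem sum_timeSpent_le [Fintype S] [Fintype A] (he : ∀ n, 0 ≤ e.hold n) (hH : 0 ≤ H) :
    ∑ x, ∑ a, e.timeSpent H x a ≤ H := by
  rw [← ENNReal.ofReal_le_ofReal_iff hH, ENNReal.ofReal_sum_of_nonneg
    fun x _ => Finset.sum_nonneg fun a _ => timeSpent_nonneg he x a]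
  simp_rw [ENNReal.ofReal_sum_of_nonneg fun a _ => timeSpent_nonneg he _ a]
  have h := tsum_sojourn_mul he hH (fun _ _ => 1)
  simp only [mul_one] at h
  rw [← h, ← ENNReal.ofReal_tsum_of_nonneg (sojourn_nonneg he) (summable_sojourn he hH)]
  exact ENNReal.ofReal_le_ofReal (tsum_sojourn_le he hH)

theorem timeSpent_le [Fintype S] [Fintype A] (he : ∀ n, 0 ≤ e.hold n) (hH : 0 ≤ H)
    (x : S) (a : A) : e.timeSpent H x a ≤ H := by
  refine le_trans ?_ (sum_timeSpent_le he hH)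
  refine le_trans ?_ (Finset.single_le_sum (f := fun x => ∑ a, e.timeSpent H x a)
    (fun x _ => Finset.sum_nonneg fun a _ => timeSpent_nonneg he x a) (Finset.mem_univ x))
  exact Finset.single_le_sum (f := fun a => e.timeSpent H x a)
    (fun a _ => timeSpent_nonneg he x a) (Finset.mem_univ a)

end Episode

/-! ### Deterministic summation and comparison of constants. -/

/-- One telescoping step: `D` is a difference of squares of `√(T + D)` and `√T`. The floor `c` keeps
`T + D` within a factor `1 + H/c` of `max T c`, although one episode may multiply `T` arbitrarily.
-/
theorem div_sqrt_max_le {T D H c : ℝ} (hT : 0 ≤ T) (hD : 0 ≤ D) (hDH : D ≤ H) (hc : 0 < c) :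
    D / √(max T c) ≤ 2 * √(1 + H / c) * (√(T + D) - √T) := by
  have hH : 0 ≤ H := hD.trans hDH
  have hm : 0 < max T c := hc.trans_le (le_max_right _ _)
  have h1 : √(T + D) ≤ √(1 + H / c) * √(max T c) := by
    rw [← Real.sqrt_mul (by positivity)]
    refine Real.sqrt_le_sqrt ?_
    have h2 : H ≤ H / c * max T c := by
      calc H = H / c * c := by field_simp
        _ ≤ _ := by gcongr; exact le_max_right _ _
    nlinarith [le_max_left T c]
  have h3 : √T ≤ √(T + D) := Real.sqrt_le_sqrt (by linarith)
  have h4 : D = (√(T + D) - √T) * (√(T + D) + √T) := by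
    nlinarith [Real.mul_self_sqrt hT, Real.mul_self_sqrt (add_nonneg hT hD)]
  rw [div_le_iff₀ (Real.sqrt_pos.2 hm)]
  calc D = (√(T + D) - √T) * (√(T + D) + √T) := h4
    _ ≤ (√(T + D) - √T) * (2 * (√(1 + H / c) * √(max T c))) := by
      gcongr
      · linarith
    _ = _ := by ring

theorem sum_div_sqrt_max_le {D : ℕ → ℝ} {H c : ℝ} {K : ℕ} (hD : ∀ k < K, 0 ≤ D k)
    (hDH : ∀ k < K, D k ≤ H) (hc : 0 < c) :
    ∑ k ∈ Finset.range K, D k / √(max (∑ l ∈ Finset.range k, D l) c) ≤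
      2 * √(1 + H / c) * √(∑ k ∈ Finset.range K, D k) := by
  induction K with
  | zero => simp
  | succ K ih =>
    rw [Finset.sum_range_succ, Finset.sum_range_succ (fun k => D k)]
    have h1 := ih (fun k hk => hD k (by omega)) (fun k hk => hDH k (by omega))
    have h2 := div_sqrt_max_le (T := ∑ l ∈ Finset.range K, D l)
      (Finset.sum_nonneg fun k hk => hD k (by simp at hk; omega)) (hD K (by omega))
      (hDH K (by omega)) hc
    linarith

theorem sum_sqrt_le_sqrt_card_mul {ι : Type*} (s : Finset ι) {T : ι → ℝ} {B : ℝ}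
    (hT : ∀ i ∈ s, 0 ≤ T i) (hB : ∑ i ∈ s, T i ≤ B) : ∑ i ∈ s, √(T i) ≤ √(s.card * B) := by
  refine Real.le_sqrt_of_sq_le (sq_sum_le_card_mul_sum_sq.trans ?_)
  gcongr
  rw [Finset.sum_congr rfl fun i hi => Real.sq_sqrt (hT i hi)]
  exact hB

/-- The pathwise bound on the regret sum weighted by truncated holding times. -/
theorem sum_tsum_sojourn_le {S A : Type*} [Fintype S] [Fintype A] {H c : ℝ} {K : ℕ}
    {E : ℕ → Episode S A} (hE : ∀ k < K, ∀ n, 0 ≤ (E k).hold n) (hH : 0 ≤ H) (hc : 0 < c) :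
    ∑ k ∈ Finset.range K, ∑' m, ENNReal.ofReal ((E k).sojourn H m) *
        ENNReal.ofReal (1 / √(max (accTime H E k ((E k).state m) ((E k).action m)) c)) ≤
      ENNReal.ofReal (2 * √(1 + H / c) * √(Fintype.card S * Fintype.card A * (K * H))) := by
  have h0 : ∀ k < K, ∀ x a, 0 ≤ (E k).timeSpent H x a :=
    fun k hk => Episode.timeSpent_nonneg (hE k hk)
  have h1 : ∀ k ∈ Finset.range K, ∑' m, ENNReal.ofReal ((E k).sojourn H m) *
        ENNReal.ofReal (1 / √(max (accTime H E k ((E k).state m) ((E k).action m)) c)) =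
      ENNReal.ofReal (∑ p : S × A, (E k).timeSpent H p.1 p.2 /
        √(max (accTime H E k p.1 p.2) c)) := by
    intro k hk
    have hk := Finset.mem_range.1 hk
    rw [Episode.tsum_sojourn_mul (hE k hk) hH
      (fun x a => ENNReal.ofReal (1 / √(max (accTime H E k x a) c))),
      ← Fintype.sum_prod_type', ENNReal.ofReal_sum_of_nonneg fun p _ =>
        div_nonneg (h0 k hk p.1 p.2) (Real.sqrt_nonneg _)]
    refine Finset.sum_congr rfl fun p _ => ?_
    rw [← ENNReal.ofReal_mul (h0 k hk _ _), mul_one_div]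
  rw [Finset.sum_congr rfl h1, ← ENNReal.ofReal_sum_of_nonneg fun k hk =>
    Finset.sum_nonneg fun p _ => div_nonneg (h0 k (Finset.mem_range.1 hk) p.1 p.2)
      (Real.sqrt_nonneg _)]
  refine ENNReal.ofReal_le_ofReal ?_
  rw [Finset.sum_comm]
  refine (Finset.sum_le_sum fun p _ => sum_div_sqrt_max_le (H := H)
    (D := fun k => (E k).timeSpent H p.1 p.2) (fun k hk => h0 k hk _ _)
    (fun k hk => Episode.timeSpent_le (hE k hk) hH _ _) hc).trans ?_
  rw [← Finset.mul_sum]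
  gcongr
  have h2 := sum_sqrt_le_sqrt_card_mul (Finset.univ : Finset (S × A)) (B := K * H)
    (T := fun p => ∑ k ∈ Finset.range K, (E k).timeSpent H p.1 p.2)
    (fun p _ => Finset.sum_nonneg fun k hk => h0 k (Finset.mem_range.1 hk) _ _) (by
      rw [Finset.sum_comm]
      refine (Finset.sum_le_card_nsmul _ _ H fun k hk => ?_).trans (by simp)
      rw [Fintype.sum_prod_type]
      exact Episode.sum_timeSpent_le (hE k (Finset.mem_range.1 hk)) hH)
  simpa using h2

/-- Comparison of the constants in the regret bound. -/
theorem constant_le {n H lmin lmax L k : ℝ} (hH : 0 ≤ H) (hl : 0 < lmin)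
    (hll : lmin ≤ lmax) (hL : 1 ≤ L) (hk : 1 < k) :
    (1 + lmax * H) * (2 * √(1 + H / (L / lmax)) * √(n * (k * H))) ≤
      √(2 * lmax) * (3 * (H + 1 / lmin) * √(n * k) *
          ((lmax * H + 1) * Real.log k / Real.log (Real.log k + 1))) := by
  have hlm : 0 < lmax := hl.trans_le hll
  have hlog : 0 < Real.log k := Real.log_pos hk
  -- From `log (1 + u) ≤ u` at `u = log k`.
  have hg : 1 ≤ Real.log k / Real.log (Real.log k + 1) := by
    rw [one_le_div (Real.log_pos (by linarith))]
    linarith [Real.log_le_sub_one_of_pos (by linarith : 0 < Real.log k + 1)]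
  have hs : 2 * √(1 + H / (L / lmax)) * √H ≤ √(2 * lmax) * (3 * (H + 1 / lmin)) := by
    have e1 : 2 * √(1 + H / (L / lmax)) * √H = √(4 * ((1 + H / (L / lmax)) * H)) := by
      rw [Real.sqrt_mul (by norm_num), Real.sqrt_mul (by positivity),
        show (4 : ℝ) = 2 ^ 2 by norm_num, Real.sqrt_sq (by norm_num)]
      ring
    have e2 : √(2 * lmax) * (3 * (H + 1 / lmin)) = √(2 * lmax * (3 * (H + 1 / lmin)) ^ 2) := by
      rw [Real.sqrt_mul (show 0 ≤ 2 * lmax by positivity), Real.sqrt_sq (by positivity)]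
    rw [e1, e2]
    refine Real.sqrt_le_sqrt ?_
    have h1 : H / (L / lmax) ≤ lmax * H := by
      rw [div_div_eq_mul_div, mul_comm]
      exact div_le_self (by positivity) hL
    -- This turns the lone 1 into a multiple of `lmax`, making both sides homogeneous.
    have h2 : 1 ≤ lmax * (1 / lmin) := by rw [mul_one_div, one_le_div hl]; exact hll
    have h3 : 0 < 1 / lmin := by positivity
    calc 4 * ((1 + H / (L / lmax)) * H) ≤ 4 * ((lmax * (1 / lmin) + lmax * H) * H) := by gcongr
      _ ≤ 2 * lmax * (3 * (H + 1 / lmin)) ^ 2 := by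
        -- This is exactly the right side minus the left side, expanded.
        have : 0 ≤ lmax * (14 * H ^ 2 + 32 * H * (1 / lmin) + 18 * (1 / lmin) ^ 2) := by positivity
        linarith
  rw [← mul_assoc n, mul_comm (n * k), Real.sqrt_mul hH]
  calc (1 + lmax * H) * (2 * √(1 + H / (L / lmax)) * (√H * √(n * k)))
      = (2 * √(1 + H / (L / lmax)) * √H) * (√(n * k) * ((lmax * H + 1) * 1)) := by ring
    _ ≤ (√(2 * lmax) * (3 * (H + 1 / lmin))) * (√(n * k) *
        ((lmax * H + 1) * (Real.log k / Real.log (Real.log k + 1)))) := by gcongr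
    _ = _ := by ring

end EpisodicCTMDP

/-! ### Exchanging remaining time for truncated holding time. -/

/-- Integrating the conditional bound gives `q P(B) ≤ P(B ∩ s)` for every `B` in `m`. This is an
inequality of measures trimmed to `m`, so it passes to every `m`-measurable `G ≥ 0`, without
integrability. -/
theorem ofReal_mul_lintegral_le_setLIntegral {Ω : Type*} {m mΩ : MeasurableSpace Ω} (hm : m ≤ mΩ)
    {P : Measure Ω} [IsFiniteMeasure P] {s : Set Ω} (hs : MeasurableSet s) {q : ℝ}
    (h : ∀ᵐ ω ∂P, q ≤ P[s.indicator (fun _ => (1 : ℝ)) | m] ω)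
    {G : Ω → ENNReal} (hG : Measurable[m] G) :
    ENNReal.ofReal q * ∫⁻ ω, G ω ∂P ≤ ∫⁻ ω in s, G ω ∂P := by
  rw [← lintegral_trim hm hG, ← lintegral_trim hm hG, ← smul_eq_mul, ← lintegral_smul_measure]
  refine lintegral_mono' ?_ le_rfl
  refine Measure.le_iff.2 fun B hB => ?_
  rw [Measure.smul_apply, trim_measurableSet_eq hm hB, trim_measurableSet_eq hm hB, smul_eq_mul,
    Measure.restrict_apply (hm _ hB), ← ofReal_measureReal, ← ofReal_measureReal,
    ← ENNReal.ofReal_mul' measureReal_nonneg]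
  refine ENNReal.ofReal_le_ofReal ?_
  have hi : Integrable (s.indicator (fun _ => (1 : ℝ))) P := (integrable_const _).indicator hs
  have h1 := setIntegral_condExp hm hi hB
  rw [integral_indicator_const _ hs, measureReal_restrict_apply hs, smul_eq_mul, mul_one] at h1
  rw [Set.inter_comm, ← h1]
  calc q * P.real B = ∫ _ in B, q ∂P := by simp [mul_comm]
    _ ≤ _ := integral_mono_ae (integrable_const _) integrable_condExp.integrableOn
      (ae_restrict_of_ae h)

/-- The integral equals `(1 - exp (-lam w)) / lam`, and `exp (-u) (1 + u) ≤ 1` with `u = lam w ≤ lam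
H` finishes. -/
theorem ofReal_le_mul_lintegral_exp {lam H w : ℝ} (hl : 0 < lam) (hw : 0 ≤ w) (hwH : w ≤ H) :
    ENNReal.ofReal w ≤ ENNReal.ofReal (1 + lam * H) *
      ∫⁻ t in Set.Ioi 0, (Set.Iio w).indicator (fun t => ENNReal.ofReal (Real.exp (-(lam * t)))) t := by
  rw [setLIntegral_indicator measurableSet_Iio, Set.inter_comm, Set.Ioi_inter_Iio,
    ← ofReal_integral_eq_lintegral_ofReal, ← ENNReal.ofReal_mul (by nlinarith)]
  · refine ENNReal.ofReal_le_ofReal ?_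
    rw [← integral_Ioc_eq_integral_Ioo, ← intervalIntegral.integral_of_le hw]
    have hint : ∫ t in (0 : ℝ)..w, Real.exp (-(lam * t)) = (1 - Real.exp (-(lam * w))) / lam := by
      have h := intervalIntegral.integral_comp_mul_left (a := 0) (b := w) Real.exp
        (c := -lam) (by linarith)
      simp only [neg_mul] at h
      rw [h, integral_exp]
      simp
      field_simp
      ring
    rw [hint, ← mul_div_assoc, le_div_iff₀ hl]
    have h1 : 0 ≤ lam * w := by positivity
    have h2 : Real.exp (-(lam * w)) * (1 + lam * w) ≤ 1 := by
      rw [Real.exp_neg, inv_mul_le_iff₀ (Real.exp_pos _)]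
      linarith [Real.add_one_le_exp (lam * w)]
    have h3 : Real.exp (-(lam * w)) ≤ 1 := Real.exp_le_one_iff.2 (by linarith)
    have h4 : lam * w ≤ lam * H := by gcongr
    nlinarith
  · exact ((Continuous.integrableOn_Icc (by fun_prop)).mono_set Set.Ioo_subset_Icc_self)
  · exact ae_of_all _ fun t => (Real.exp_pos _).le

/-- Layer-cake form, which separates the events `t < τ` and `t < W` so that the first can be
conditioned at fixed `t`. -/
theorem ofReal_min_eq_setLIntegral (a b : ℝ) (g : ENNReal) :
    ENNReal.ofReal (min a b) * g =
      ∫⁻ t in Set.Ioi (0 : ℝ), (Set.Iio a).indicator (fun t => (Set.Iio b).indicator (fun _ => g) t) t := by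
  rw [setLIntegral_indicator measurableSet_Iio, setLIntegral_indicator measurableSet_Iio,
    setLIntegral_const]
  have : Set.Iio b ∩ (Set.Iio a ∩ Set.Ioi 0) = Set.Ioo 0 (min a b) := by
    ext t; simp; tauto
  rw [this, Real.volume_Ioo, sub_zero, mul_comm]

/-- A holding time whose conditional law is dominated from below by an exponential law is, once
truncated at a bounded time known in advance, on average comparable to the truncation time. -/
theorem lintegral_ofReal_mul_le_of_exp_le_condExp {Ω : Type*} {m mΩ : MeasurableSpace Ω}
    (hm : m ≤ mΩ) {P : Measure Ω} [IsFiniteMeasure P] {τ W : Ω → ℝ} (hτ : Measurable τ)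
    (hW : Measurable[m] W) {lam H : ℝ} (hl : 0 < lam) (hW0 : ∀ᵐ ω ∂P, 0 ≤ W ω)
    (hWH : ∀ᵐ ω ∂P, W ω ≤ H)
    (htail : ∀ t : ℝ, 0 ≤ t → ∀ᵐ ω ∂P,
      Real.exp (-(lam * t)) ≤ P[Set.indicator {ω | t < τ ω} (fun _ => (1 : ℝ)) | m] ω)
    {G : Ω → ENNReal} (hG : Measurable[m] G) :
    ∫⁻ ω, ENNReal.ofReal (W ω) * G ω ∂P ≤
      ENNReal.ofReal (1 + lam * H) * ∫⁻ ω, ENNReal.ofReal (min (τ ω) (W ω)) * G ω ∂P := by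
  have hW' : Measurable W := hW.mono hm le_rfl
  have hG' : Measurable G := hG.mono hm le_rfl
  have hWs : MeasurableSet {p : Ω × ℝ | p.2 < W p.1} :=
    measurableSet_lt measurable_snd (hW'.comp measurable_fst)
  have hτs : MeasurableSet {p : Ω × ℝ | p.2 < τ p.1} :=
    measurableSet_lt measurable_snd (hτ.comp measurable_fst)
  -- By Tonelli both sides become integrals over `t`, so the tail bound is needed only for each
  -- fixed `t`, where its null set is harmless.
  have key : ∫⁻ ω, G ω * (∫⁻ t in Set.Ioi (0 : ℝ), (Set.Iio (W ω)).indicator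
        (fun t => ENNReal.ofReal (Real.exp (-(lam * t)))) t) ∂P ≤
      ∫⁻ ω, ENNReal.ofReal (min (τ ω) (W ω)) * G ω ∂P := by
    simp_rw [ofReal_min_eq_setLIntegral]
    rw [lintegral_lintegral_swap (f := fun ω t => (Set.Iio (τ ω)).indicator
      (fun t => (Set.Iio (W ω)).indicator (fun _ => G ω) t) t)]
    swap
    · exact (((hG'.comp measurable_fst).indicator hWs).indicator hτs).aemeasurable
    have h1 : ∀ ω, G ω * ∫⁻ t in Set.Ioi 0, (Set.Iio (W ω)).indicator
        (fun t => ENNReal.ofReal (Real.exp (-(lam * t)))) t =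
        ∫⁻ t in Set.Ioi 0, (Set.Iio (W ω)).indicator
        (fun t => G ω * ENNReal.ofReal (Real.exp (-(lam * t)))) t := by
      intro ω
      rw [← lintegral_const_mul _ (Measurable.indicator (by fun_prop) measurableSet_Iio)]
      simp_rw [Set.indicator_apply, mul_ite, mul_zero]
    simp_rw [h1]
    rw [lintegral_lintegral_swap (f := fun ω t => (Set.Iio (W ω)).indicator
        (fun t => G ω * ENNReal.ofReal (Real.exp (-(lam * t)))) t)]
    swap
    · refine AEMeasurable.indicator (f := fun p : Ω × ℝ =>
        G p.1 * ENNReal.ofReal (Real.exp (-(lam * p.2)))) (s := {p : Ω × ℝ | p.2 < W p.1})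
        (Measurable.aemeasurable ?_) hWs
      exact (hG'.comp measurable_fst).mul (by fun_prop)
    refine setLIntegral_mono' measurableSet_Ioi fun t ht => ?_
    -- Since `W` is known in advance, cutting `G` off at `t < W` keeps it `m`-measurable.
    have hGt : Measurable[m] ({ω | t < W ω}.indicator G) :=
      hG.indicator (hW measurableSet_Ioi)
    have h2 := ofReal_mul_lintegral_le_setLIntegral hm (hτ measurableSet_Ioi)
      (htail t (le_of_lt ht)) hGt
    rw [← lintegral_const_mul _ (hGt.mono hm le_rfl),
      ← lintegral_indicator (hτ measurableSet_Ioi)] at h2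
    refine le_of_eq_of_le (lintegral_congr fun ω => ?_) (h2.trans_eq (lintegral_congr fun ω => ?_))
    · by_cases h : t < W ω <;> simp [Set.indicator, h, mul_comm]
    · by_cases h : t < W ω <;> simp [Set.indicator, h]
  refine le_trans ?_ (mul_le_mul_right key _)
  rw [← lintegral_const_mul' _ _ ENNReal.ofReal_ne_top]
  refine lintegral_mono_ae ?_
  filter_upwards [hW0, hWH] with ω h0 h1
  rw [mul_left_comm, mul_comm]
  gcongr
  exact ofReal_le_mul_lintegral_exp hl h0 h1

namespace EpisodicCTMDP

/-! ### Measurability with respect to the history. -/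

section History

variable {Ω S A : Type*} [mS : MeasurableSpace S] [mA : MeasurableSpace A]
  {E : ℕ → Ω → Episode S A} {k m : ℕ}

theorem measurable_state_history_past {l : ℕ} (hl : l < k) (n : ℕ) :
    Measurable[history E k m] fun ω => (E l ω).state n := by
  refine Measurable.of_comap_le (le_trans ?_ (le_sup_of_le_left le_sup_left))
  refine le_trans ?_ (le_iSup₂_of_le l hl (le_iSup_of_le n le_rfl))
  exact le_sup_of_le_left le_sup_left

theorem measurable_action_history_past {l : ℕ} (hl : l < k) (n : ℕ) :
    Measurable[history E k m] fun ω => (E l ω).action n := by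
  refine Measurable.of_comap_le (le_trans ?_ (le_sup_of_le_left le_sup_left))
  refine le_trans ?_ (le_iSup₂_of_le l hl (le_iSup_of_le n le_rfl))
  exact le_sup_of_le_left le_sup_right

theorem measurable_hold_history_past {l : ℕ} (hl : l < k) (n : ℕ) :
    Measurable[history E k m] fun ω => (E l ω).hold n := by
  refine Measurable.of_comap_le (le_trans ?_ (le_sup_of_le_left le_sup_left))
  rw [BorelSpace.measurable_eq (α := ℝ)]
  refine le_trans ?_ (le_iSup₂_of_le l hl (le_iSup_of_le n le_rfl))
  exact le_sup_right

theorem measurable_state_history {n : ℕ} (hn : n ≤ m) :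
    Measurable[history E k m] fun ω => (E k ω).state n := by
  refine Measurable.of_comap_le (le_sup_of_le_left (le_sup_of_le_right ?_))
  exact le_iSup₂_of_le n hn le_sup_left

theorem measurable_action_history {n : ℕ} (hn : n ≤ m) :
    Measurable[history E k m] fun ω => (E k ω).action n := by
  refine Measurable.of_comap_le (le_sup_of_le_left (le_sup_of_le_right ?_))
  exact le_iSup₂_of_le n hn le_sup_right

theorem measurable_hold_history {n : ℕ} (hn : n < m) :
    Measurable[history E k m] fun ω => (E k ω).hold n := by
  refine Measurable.of_comap_le (le_sup_of_le_right ?_)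
  rw [BorelSpace.measurable_eq (α := ℝ)]
  exact le_iSup₂_of_le n hn le_rfl

theorem measurable_jumpTime_history {n : ℕ} (hn : n ≤ m) :
    Measurable[history E k m] fun ω => (E k ω).jumpTime n :=
  Finset.measurable_fun_sum _ fun _ hi =>
    measurable_hold_history ((Finset.mem_range.1 hi).trans_le hn)

end History

end EpisodicCTMDP

namespace EpisodicCTMDP

section Measurability

variable {Ω S A : Type*} [MeasurableSpace S] [DiscreteMeasurableSpace S]
  [MeasurableSpace A] [DiscreteMeasurableSpace A] {E : ℕ → Ω → Episode S A}

theorem measurable_accTime_history (H : ℝ) (k m : ℕ) (x : S) (a : A) :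
    Measurable[history E k m] fun ω => accTime H (fun l => E l ω) k x a := by
  let _ := history E k m
  refine Finset.measurable_fun_sum _ fun l hl => Measurable.tsum fun n => ?_
  have hl := Finset.mem_range.1 hl
  have hj : Measurable[history E k m] fun ω => (E l ω).jumpTime n :=
    Finset.measurable_fun_sum _ fun i _ => measurable_hold_history_past hl i
  refine Measurable.ite (MeasurableSet.inter (MeasurableSet.inter ?_ ?_) ?_) ?_ measurable_const
  · exact measurable_state_history_past hl n (MeasurableSet.of_discrete (s := {x}))
  · exact measurable_action_history_past hl n (MeasurableSet.of_discrete (s := {a}))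
  · exact hj measurableSet_Iic
  · exact (measurable_hold_history_past hl n).min (measurable_const.sub hj)

theorem measurable_accTime_state_action_history [Countable S] [Countable A] (H : ℝ) (k m : ℕ) :
    Measurable[history E k m] fun ω =>
      accTime H (fun l => E l ω) k ((E k ω).state m) ((E k ω).action m) := by
  let _ := history E k m
  -- There are countably many pairs, so joint measurability reduces to each fixed pair; the random
  -- current pair is substituted afterwards.
  have hf : Measurable fun q : (S × A) × Ω => accTime H (fun l => E l q.2) k q.1.1 q.1.2 :=
    measurable_from_prod_countable_right fun p => measurable_accTime_history H k m p.1 p.2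
  exact hf.comp ((Measurable.prodMk (measurable_state_history le_rfl)
    (measurable_action_history le_rfl)).prodMk measurable_id)

end Measurability

/-! ### Conditional law of the holding times along a run. -/

section Run

variable {Ω S A : Type*} [mΩ : MeasurableSpace Ω] [Fintype S] [MeasurableSpace S]
  [MeasurableSpace A] {P : Measure Ω} {M : CTMDP S A} {algo : LearningAlgorithm S A} {K k : ℕ}
  {E : ℕ → Ω → Episode S A}

theorem IsRun.history_le (hE : IsRun P M algo K E) (hk : k < K) (m : ℕ) :
    history E k m ≤ mΩ := by
  refine sup_le (sup_le (iSup₂_le fun l hl => iSup_le fun n => sup_le (sup_le ?_ ?_) ?_)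
    (iSup₂_le fun n _ => sup_le ?_ ?_)) (iSup₂_le fun n _ => ?_)
  · exact (hE.measurable_state l (hl.trans hk) n).comap_le
  · exact (hE.measurable_action l (hl.trans hk) n).comap_le
  · rw [← BorelSpace.measurable_eq (α := ℝ)]
    exact (hE.measurable_hold l (hl.trans hk) n).comap_le
  · exact (hE.measurable_state k hk n).comap_le
  · exact (hE.measurable_action k hk n).comap_le
  · rw [← BorelSpace.measurable_eq (α := ℝ)]
    exact (hE.measurable_hold k hk n).comap_le

/-- Given the history, the holding time exceeds `t` with probability `exp (-λ t)`. -/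
theorem IsRun.condExp_hold_gt [DiscreteMeasurableSpace S] [IsFiniteMeasure P]
    (hE : IsRun P M algo K E) (hk : k < K) (n : ℕ) {t : ℝ} (ht : 0 ≤ t) :
    P[Set.indicator {ω | t < (E k ω).hold n} (fun _ => (1 : ℝ)) | history E k n] =ᵐ[P]
      fun ω => Real.exp (-(M.rate ((E k ω).state n) ((E k ω).action n) * t)) := by
  classical
  have hm := hE.history_le hk n
  set s : S → Set Ω := fun y => {ω | (E k ω).hold n ≤ t ∧ (E k ω).state (n + 1) = y} with hs
  have hsm : ∀ y, MeasurableSet (s y) := fun y =>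
    (measurableSet_le (hE.measurable_hold k hk n) measurable_const).inter
      (hE.measurable_state k hk (n + 1) (MeasurableSet.of_discrete (s := {y})))
  have hsi : ∀ y, Integrable ((s y).indicator fun _ => (1 : ℝ)) P := fun y =>
    (integrable_const _).indicator (hsm y)
  -- The event `τ ≤ t` is partitioned by the next state, over which the transition probabilities sum
  -- to 1.
  have hind : Set.indicator {ω | t < (E k ω).hold n} (fun _ => (1 : ℝ)) =
      (fun _ => 1) - ∑ y, (s y).indicator fun _ => (1 : ℝ) := by
    funext ω
    simp only [Pi.sub_apply, Finset.sum_apply, Set.indicator_apply, hs, Set.mem_ofPred_eq]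
    by_cases h : t < (E k ω).hold n
    · simp [h, not_le.2 h]
    · simp [h, not_lt.1 h]
  rw [hind]
  have h1 := condExp_sub (integrable_const (1 : ℝ)) (integrable_finsetSum' Finset.univ
    fun y _ => hsi y) (μ := P) (history E k n)
  have h2 := condExp_finsetSum (s := Finset.univ) (fun y _ => hsi y) (history E k n)
  have h3 : ∀ᵐ ω ∂P, ∀ y, (P[(s y).indicator (fun _ => (1 : ℝ)) | history E k n]) ω = _ :=
    ae_all_iff.2 fun y => hE.step_law k hk n t ht y
  filter_upwards [h1, h2, h3] with ω e1 e2 e3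
  rw [e1, Pi.sub_apply, e2, condExp_const hm, Finset.sum_apply, Finset.sum_congr rfl fun y _ => e3 y,
    ← Finset.mul_sum, M.trans_sum]
  ring

/-- The tail formula at `t = 0` has value 1. Positivity is not part of `Episode`, so it comes from
the law and holds only almost surely. -/
theorem IsRun.ae_hold_pos [DiscreteMeasurableSpace S] [IsFiniteMeasure P]
    (hE : IsRun P M algo K E) (hk : k < K) (n : ℕ) : ∀ᵐ ω ∂P, 0 < (E k ω).hold n := by
  have hs : MeasurableSet {ω | 0 < (E k ω).hold n} :=
    measurableSet_lt measurable_const (hE.measurable_hold k hk n)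
  have h := ofReal_mul_lintegral_le_setLIntegral (hE.history_le hk n) hs (q := 1)
    (by filter_upwards [hE.condExp_hold_gt hk n le_rfl] with ω hω; simp [hω])
    (measurable_const (a := (1 : ENNReal)))
  simp only [ENNReal.ofReal_one, lintegral_const, MeasurableSet.univ, Measure.restrict_apply,
    Set.univ_inter, one_mul] at h
  exact (ae_iff_measure_eq hs.nullMeasurableSet).2
    (le_antisymm (measure_mono (Set.subset_univ _)) h)

theorem IsRun.ae_hold_nonneg [DiscreteMeasurableSpace S] [IsFiniteMeasure P]
    (hE : IsRun P M algo K E) : ∀ᵐ ω ∂P, ∀ k < K, ∀ n, 0 ≤ (E k ω).hold n := by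
  refine ae_all_iff.2 fun k => ?_
  by_cases hk : k < K
  · filter_upwards [ae_all_iff.2 fun n => hE.ae_hold_pos hk n] with ω h _ n using (h n).le
  · simp [hk]

theorem IsRun.lintegral_remaining_mul_le [DiscreteMeasurableSpace S] [IsFiniteMeasure P]
    (hE : IsRun P M algo K E) {lmin lmax : ℝ} (hM : M.IsBounded lmin lmax) (hk : k < K) (n : ℕ)
    {G : Ω → ENNReal} (hG : Measurable[history E k n] G) :
    ∫⁻ ω, ENNReal.ofReal (max (M.horizon - (E k ω).jumpTime n) 0) * G ω ∂P ≤
      ENNReal.ofReal (1 + lmax * M.horizon) *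
        ∫⁻ ω, ENNReal.ofReal ((E k ω).sojourn M.horizon n) * G ω ∂P := by
  refine lintegral_ofReal_mul_le_of_exp_le_condExp (hE.history_le hk n)
    (hE.measurable_hold k hk n) ?_ hM.lmax_pos (ae_of_all _ fun ω => le_max_right _ _) ?_
    (fun t ht => ?_) hG
  · exact (measurable_const.sub (measurable_jumpTime_history le_rfl)).max measurable_const
  · filter_upwards [hE.ae_hold_nonneg] with ω h
    have : 0 ≤ (E k ω).jumpTime n := Finset.sum_nonneg fun i _ => h k hk i
    exact max_le (by linarith) M.horizon_pos.le
  · filter_upwards [hE.condExp_hold_gt hk n ht] with ω hω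
    rw [hω]
    gcongr
    exact hM.rate_le _ _

end Run

/-- The argument of the logarithm is at least 4, and `4 log 4 = 8 log 2 > 1`. This yields `H / c ≤
lmax H` for the floor `c = L / lmax`. -/
theorem one_le_logTerm (S A : Type*) [Fintype S] [Fintype A] [Nonempty S] [Nonempty A] {K : ℕ}
    (hK : 2 ≤ K) {δ : ℝ} (hδ0 : 0 < δ) (hδ1 : δ < 1) : 1 ≤ logTerm S A K δ := by
  have hS : (1 : ℝ) ≤ Fintype.card S := by exact_mod_cast Fintype.card_pos
  have hA : (1 : ℝ) ≤ Fintype.card A := by exact_mod_cast Fintype.card_pos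
  have hK' : (2 : ℝ) ≤ K := by exact_mod_cast hK
  have h : (4 : ℝ) ≤ 2 * Fintype.card S * Fintype.card A * K / δ := by
    rw [le_div_iff₀ hδ0]
    calc 4 * δ ≤ 2 * 1 * 1 * 2 := by linarith
      _ ≤ _ := by gcongr
  have h4 : Real.log 4 = 2 * Real.log 2 := by
    rw [show (4 : ℝ) = 2 ^ 2 by norm_num, Real.log_pow]; norm_num
  have := Real.log_le_log (by norm_num) h
  unfold logTerm
  linarith [Real.log_two_gt_d9]

end EpisodicCTMDP

/-! ### Assembly of the expectation bound. -/

open EpisodicCTMDP in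
theorem lintegral_sum_tsum_le {S A Ω : Type*}
    [Fintype S] [MeasurableSpace S] [DiscreteMeasurableSpace S]
    [Fintype A] [MeasurableSpace A] [DiscreteMeasurableSpace A]
    [MeasurableSpace Ω] {P : Measure Ω} [IsProbabilityMeasure P]
    {M : CTMDP S A} {lmin lmax : ℝ} (hM : M.IsBounded lmin lmax)
    {algo : LearningAlgorithm S A} {K : ℕ} {c : ℝ} (hc : 0 < c)
    {E : ℕ → Ω → Episode S A} (hE : IsRun P M algo K E) :
    ∫⁻ ω, ∑ k ∈ Finset.range K, ∑' m : ℕ,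
        ENNReal.ofReal (max (M.horizon - (E k ω).jumpTime m) 0 /
          √(max (accTime M.horizon (fun l => E l ω) k ((E k ω).state m) ((E k ω).action m)) c)) ∂P
      ≤ ENNReal.ofReal ((1 + lmax * M.horizon) * (2 * √(1 + M.horizon / c) *
          √(Fintype.card S * Fintype.card A * (K * M.horizon)))) := by
  have hH := M.horizon_pos.le
  have hlH : 0 ≤ 1 + lmax * M.horizon := by have := hM.lmax_pos; positivity
  set W : ℕ → ℕ → Ω → ENNReal := fun k m ω =>
    ENNReal.ofReal (max (M.horizon - (E k ω).jumpTime m) 0)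
  set D : ℕ → ℕ → Ω → ENNReal := fun k m ω => ENNReal.ofReal ((E k ω).sojourn M.horizon m)
  set G : ℕ → ℕ → Ω → ENNReal := fun k m ω => ENNReal.ofReal (1 / √(max (accTime M.horizon
      (fun l => E l ω) k ((E k ω).state m) ((E k ω).action m)) c))
  have hj : ∀ k < K, ∀ m, Measurable fun ω => (E k ω).jumpTime m := fun k hk m =>
    Finset.measurable_fun_sum _ fun i _ => hE.measurable_hold k hk i
  have hG : ∀ k m, Measurable[history E k m] (G k m) := fun k m =>
    (measurable_const.div ((measurable_accTime_state_action_history _ k m).max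
      measurable_const).sqrt).ennreal_ofReal
  have hGm : ∀ k < K, ∀ m, Measurable (G k m) := fun k hk m =>
    (hG k m).mono (hE.history_le hk m) le_rfl
  have hWm : ∀ k < K, ∀ m, Measurable (W k m) := fun k hk m =>
    ((measurable_const.sub (hj k hk m)).max measurable_const).ennreal_ofReal
  have hDm : ∀ k < K, ∀ m, Measurable (D k m) := fun k hk m =>
    ((hE.measurable_hold k hk m).min
      ((measurable_const.sub (hj k hk m)).max measurable_const)).ennreal_ofReal
  calc _ = ∫⁻ ω, ∑ k ∈ Finset.range K, ∑' m, W k m ω * G k m ω ∂P := by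
        refine lintegral_congr fun ω => Finset.sum_congr rfl fun k hk => tsum_congr fun m => ?_
        simp only [W, G]
        rw [← ENNReal.ofReal_mul (le_max_right _ _), mul_one_div]
    _ = ∑ k ∈ Finset.range K, ∑' m, ∫⁻ ω, W k m ω * G k m ω ∂P := by
        rw [lintegral_finsetSum']
        · exact Finset.sum_congr rfl fun k hk => lintegral_tsum fun m =>
            ((hWm k (Finset.mem_range.1 hk) m).mul (hGm k (Finset.mem_range.1 hk) m)).aemeasurable
        · exact fun k hk => (Measurable.tsum fun m =>
            (hWm k (Finset.mem_range.1 hk) m).mul (hGm k (Finset.mem_range.1 hk) m)).aemeasurable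
    -- The exchange is made term by term, each term conditioned on its own history; the sums are
    -- then reassembled for the pathwise bound.
    _ ≤ ∑ k ∈ Finset.range K, ∑' m, ENNReal.ofReal (1 + lmax * M.horizon) *
          ∫⁻ ω, D k m ω * G k m ω ∂P :=
        Finset.sum_le_sum fun k hk => ENNReal.tsum_le_tsum fun m =>
          hE.lintegral_remaining_mul_le hM (Finset.mem_range.1 hk) m (hG k m)
    _ = ENNReal.ofReal (1 + lmax * M.horizon) *
          ∫⁻ ω, ∑ k ∈ Finset.range K, ∑' m, D k m ω * G k m ω ∂P := by
        simp_rw [ENNReal.tsum_mul_left]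
        rw [← Finset.mul_sum, lintegral_finsetSum']
        · congr 1
          exact Finset.sum_congr rfl fun k hk => (lintegral_tsum fun m =>
            ((hDm k (Finset.mem_range.1 hk) m).mul
              (hGm k (Finset.mem_range.1 hk) m)).aemeasurable).symm
        · exact fun k hk => (Measurable.tsum fun m =>
            (hDm k (Finset.mem_range.1 hk) m).mul (hGm k (Finset.mem_range.1 hk) m)).aemeasurable
    _ ≤ ENNReal.ofReal (1 + lmax * M.horizon) * ∫⁻ _, ENNReal.ofReal (2 * √(1 + M.horizon / c) *
          √(Fintype.card S * Fintype.card A * (K * M.horizon))) ∂P := by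
        refine mul_le_mul_right (lintegral_mono_ae ?_) _
        filter_upwards [hE.ae_hold_nonneg] with ω h
        exact sum_tsum_sojourn_le h hH hc
    _ = _ := by
        rw [lintegral_const, measure_univ, mul_one, ENNReal.ofReal_mul hlH]

theorem mainTheorem5 {S A Ω : Type*}
    [Fintype S] [MeasurableSpace S] [DiscreteMeasurableSpace S]
    [Fintype A] [MeasurableSpace A] [DiscreteMeasurableSpace A]
    [MeasurableSpace Ω] (P : Measure Ω) [IsProbabilityMeasure P]
    (M : EpisodicCTMDP.CTMDP S A) (lmin lmax : ℝ) (hM : M.IsBounded lmin lmax)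
    (algo : EpisodicCTMDP.LearningAlgorithm S A) (K : ℕ) (hK : 2 ≤ K)
    (δ : ℝ) (hδ0 : 0 < δ) (hδ1 : δ < 1)
    (E : ℕ → Ω → EpisodicCTMDP.Episode S A) (hE : EpisodicCTMDP.IsRun P M algo K E) :
    ∫⁻ ω, ∑ k ∈ Finset.range K, ∑' m : ℕ,
        ENNReal.ofReal (max (M.horizon - (E k ω).jumpTime m) 0 /
          √(max (EpisodicCTMDP.accTime M.horizon (fun l => E l ω) k
              ((E k ω).state m) ((E k ω).action m))
            (EpisodicCTMDP.logTerm S A K δ / lmax))) ∂P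
      ≤ ENNReal.ofReal (√(2 * lmax) * (3 * (M.horizon + 1 / lmin) *
          √(Fintype.card S * Fintype.card A * K) *
          ((lmax * M.horizon + 1) * Real.log K / Real.log (Real.log K + 1)))) := by
  obtain ⟨ω⟩ : Nonempty Ω := nonempty_of_isProbabilityMeasure P
  have : Nonempty S := ⟨M.init⟩
  -- An action exists because a trajectory contains one; it also supplies a rate witnessing `lmin ≤
  -- lmax`.
  have : Nonempty A := ⟨(E 0 ω).action 0⟩
  have hL := EpisodicCTMDP.one_le_logTerm S A hK hδ0 hδ1
  have hl := hM.lmax_pos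
  refine (lintegral_sum_tsum_le hM (by positivity) hE).trans (ENNReal.ofReal_le_ofReal ?_)
  exact EpisodicCTMDP.constant_le M.horizon_pos.le hM.lmin_pos
    ((hM.le_rate M.init ((E 0 ω).action 0)).trans (hM.rate_le _ _)) hL (by exact_mod_cast hK)
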